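/- Let $G$ be a nontrivial Carnot group, presented on a finite-dimensional real vector space: $G$ carries a Lie group structure with identity $0$, its Lie algebra is stratified, $\mathfrak g=\mathfrak g_1\oplus\dots\oplus\mathfrak g_s$ with $\mathfrak g_{i+1}=[\mathfrak g_1,\mathfrak g_i]$ and $[\mathfrak g_1,\mathfrak g_s]=0$, and the dilations $\delta_r(X_1+\dots+X_s)=rX_1+\dots+r^sX_s$ ($r>0$, $X_i\in\mathfrak g_i$) are group automorphisms. Let $dq$ be Lebesgue measure on $G$ and $Q=\sum_i i\,\dim\mathfrak g_i$. Let $\mathcal N:G\to[0,\infty)$ be a symmetric pseudonorm, i.e. $\mathcal N$ is continuous, $\mathcal N(\delta_r p)=r\mathcal N(p)$ for $r>0$, $\mathcal N(p)>0$ if and only if $p\neq 0$, and $\mathcal N(p^{-1})=\mathcal N(p)$. Put $B(p,R)=\{q:\mathcal N(p^{-1}q)\le R\}$ and $S(0,1)=\{q:\mathcal N(q)=1\}$. Suppose that for some integer $k\ge 1$ the function $$\psi(q)=C\,e^{-1/(1-\mathcal N(q)^k)}\ \text{ if } \mathcal N(q)<1,\qquad \psi(q)=0\ \text{ if } \mathcal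 N(q)\ge 1,$$ with $C>0$ chosen so that $\int_G\psi\,dq=1$, is $C^\infty$ on $G$. There is a unique Radon measure $\sigma$ on $S(0,1)$ such that $$\int_G f(q)\,dq=\int_0^\infty\int_{S(0,1)}f(\delta_r v)\,r^{Q-1}\,d\sigma(v)\,dr$$ for all Borel functions $f:G\to[0,\infty]$. For every locally integrable function $u:G\to\mathbb R$ the following two properties are equivalent: 1. (volume mean value property) $u(p)=\frac1{|B(p,R)|}\int_{B(p,R)}u(q)\,dq$ for all $p\in G$ and all $R>0$; 2. (spherical mean value property) for all $p\in G$ and all $r>0$ the function $v\mapsto u(p\,\delta_r(v))$ is $\sigma$-integrable on $S(0,1)$ and $u(p)\int_{S(0,1)}d\sigma(v)=\int_{S(0,1)}u(p\,\delta_r(v))\,d\sigma(v)$. Either property implies that $u\in C^\infty(G)$, and that $u=u*\psi_\varepsilon$ for every $\varepsilon>0$, where $\psi_\varepsilon=\varepsilon^{-Q}\,\psi\circ\delta_{1/\varepsilon}$ and $(g*h)(p)=\int_G g(q)\,h(q^{-1}p)\,dq$. -/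

import Mathlib

open MeasureTheory
open scoped Manifold ContDiff

/-! Carnot groups are presented as Lie group structures on a finite dimensional real vector space
`G` (addition and scalar multiplication are those of the vector space, `p * q`, `p⁻¹`, `1` are the
operations of the Lie group). The Lie algebra of `G` is Mathlib's `GroupLieAlgebra`, that is the
tangent space at `1` with the bracket of left invariant vector fields; as `G` is a vector space,
this tangent space is `G` itself. -/

/-- The Lie bracket on the Lie algebra of `G`, as an operation on the vector space `G`. -/
noncomputable def carnotBracket {G : Type*} [NormedAddCommGroup G] [NormedSpace ℝ G] [Group G]
    (x y : G) : G :=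
  @Bracket.bracket (GroupLieAlgebra 𝓘(ℝ, G) G) (GroupLieAlgebra 𝓘(ℝ, G) G) _ x y

/-- A stratification `𝔤 = 𝔤₁ ⊕ ⋯ ⊕ 𝔤ₛ` of the Lie algebra of `G`:
`𝔤ᵢ₊₁ = [𝔤₁, 𝔤ᵢ]` for `1 ≤ i`, and `𝔤ᵢ = 0` for `i > s` (so that `[𝔤₁, 𝔤ₛ] = 0`).
The index `0` carries the zero space. -/
structure Stratification (G : Type*) [NormedAddCommGroup G] [NormedSpace ℝ G] [Group G] where
  step : ℕ
  layer : ℕ → Submodule ℝ G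
  layer_zero : layer 0 = ⊥
  layer_of_step_lt : ∀ i, step < i → layer i = ⊥
  isInternal : DirectSum.IsInternal layer
  layer_succ : ∀ i, 1 ≤ i → layer (i + 1) =
    Submodule.span ℝ {z | ∃ x ∈ layer 1, ∃ y ∈ layer i, z = carnotBracket x y}

namespace Stratification

variable {G : Type*} [NormedAddCommGroup G] [NormedSpace ℝ G] [Group G]

/-- The projection of `G` onto the `i`-th layer along the other layers. -/
noncomputable def proj (S : Stratification G) (i : ℕ) : G →ₗ[ℝ] G :=
  (S.layer i).subtype ∘ₗ DirectSum.component ℝ ℕ (fun j => S.layer j) i ∘ₗ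
    (LinearEquiv.ofBijective (DirectSum.coeLinearMap S.layer) S.isInternal).symm.toLinearMap

/-- The dilation `δ_r (X₁ + ⋯ + Xₛ) = r X₁ + r² X₂ + ⋯ + rˢ Xₛ`. -/
noncomputable def dilation (S : Stratification G) (r : ℝ) : G →ₗ[ℝ] G :=
  ∑ i ∈ Finset.Icc 1 S.step, r ^ i • S.proj i

/-- The homogeneous (Hausdorff) dimension `Q = ∑ i · dim 𝔤ᵢ`. -/
noncomputable def homDim (S : Stratification G) : ℕ :=
  ∑ i ∈ Finset.Icc 1 S.step, i * Module.finrank ℝ (S.layer i)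

end Stratification

/-- A (homogeneous) Carnot group: a Lie group structure on a vector space, with identity `0` and
stratified Lie algebra, such that the dilations defined by the stratification are automorphisms
of the group. -/
structure CarnotStructure (G : Type*) [NormedAddCommGroup G] [NormedSpace ℝ G] [Group G]
    extends Stratification G where
  one_eq_zero : (1 : G) = 0
  dilation_mul : ∀ r : ℝ, 0 < r → ∀ p q : G,
    toStratification.dilation r (p * q) =
      toStratification.dilation r p * toStratification.dilation r q

namespace CarnotStructure

variable {G : Type*} [NormedAddCommGroup G] [NormedSpace ℝ G] [Group G]

/-- Symmetric pseudonorms on a Carnot group. -/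
structure IsPseudonorm (S : CarnotStructure G) (N : G → ℝ) : Prop where
  continuous : Continuous N
  nonneg : ∀ p, 0 ≤ N p
  homogeneous : ∀ r : ℝ, 0 < r → ∀ p, N (S.dilation r p) = r * N p
  pos_iff : ∀ p, 0 < N p ↔ p ≠ 0
  symm : ∀ p, N p⁻¹ = N p

/-- The ball `B(p, r)` of the pseudodistance `d(p, q) = N (p⁻¹ q)`. -/
def pball (N : G → ℝ) (p : G) (r : ℝ) : Set G := {q | N (p⁻¹ * q) ≤ r}

/-- The unit sphere `S(0, 1)` of `N`. -/
def unitSphere (N : G → ℝ) : Set G := {q | N q = 1}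

open Classical in
/-- The bump function before normalization. -/
noncomputable def rawBump (N : G → ℝ) (k : ℕ) (q : G) : ℝ :=
  if N q < 1 then Real.exp (-(1 / (1 - N q ^ k))) else 0

/-- The radial bump function `ψ`, normalized to have integral one. -/
noncomputable def bump [MeasurableSpace G] (μ : Measure G) (N : G → ℝ) (k : ℕ) (q : G) : ℝ :=
  (∫ x, rawBump N k x ∂μ)⁻¹ * rawBump N k q

/-- The rescaled function `ψ_ε = ε^{-Q} ψ ∘ δ_{1/ε}`. -/
noncomputable def rescale (S : CarnotStructure G) (ψ : G → ℝ) (ε : ℝ) (q : G) : ℝ :=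
  (ε ^ S.homDim)⁻¹ * ψ (S.dilation (1 / ε) q)

/-- The group convolution `(g * h)(p) = ∫ g(q) h(q⁻¹ p) dq`. -/
noncomputable def conv [MeasurableSpace G] (μ : Measure G) (g h : G → ℝ) (p : G) : ℝ :=
  ∫ q, g q * h (q⁻¹ * p) ∂μ

/-- `σ` is a Radon measure on the unit sphere of `N` for which integration in polar coordinates
holds: `∫_G f dq = ∫_0^∞ ∫_{S(0,1)} f(δ_r v) r^{Q-1} dσ(v) dr`. -/
structure IsPolarMeasure [MeasurableSpace G] (S : CarnotStructure G) (μ : Measure G) (N : G → ℝ)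
    (σ : Measure (unitSphere N)) : Prop where
  radon : σ.Regular
  polar : ∀ f : G → ENNReal, Measurable f →
    ∫⁻ q, f q ∂μ = ∫⁻ r in Set.Ioi (0 : ℝ), ∫⁻ v : unitSphere N,
      f (S.dilation r v) * ENNReal.ofReal (r ^ (S.homDim - 1)) ∂σ

/-- The volume mean value property on all balls of `N`. -/
def VolumeMVP [MeasurableSpace G] (μ : Measure G) (N : G → ℝ) (u : G → ℝ) : Prop :=
  ∀ p : G, ∀ R : ℝ, 0 < R → u p = ⨍ q in pball N p R, u q ∂μ

/-- The spherical mean value property on all spheres of `N`; that the spherical integrals exist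
is part of the property. -/
def SphericalMVP [MeasurableSpace G] (S : CarnotStructure G) (N : G → ℝ)
    (σ : Measure (unitSphere N)) (u : G → ℝ) : Prop :=
  ∀ p : G, ∀ r : ℝ, 0 < r →
    Integrable (fun v : unitSphere N => u (p * S.dilation r v)) σ ∧
    u p * ∫ _v : unitSphere N, (1 : ℝ) ∂σ = ∫ v : unitSphere N, u (p * S.dilation r v) ∂σ

end CarnotStructure

/-! Both properties reduce to a single weaker one: for every `p`, the spherical mean of `u` around
`p` equals `u p` for almost every radius `r`.

In polar coordinates around `p`, the integral of `u` over `B(p, R)` is the integral over `(0, R]` of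
the spherical integrals against `r^{Q-1} dr`. If the ball identity holds for all `R`, the deviation
of the spherical integrals has zero integral over every half line, hence vanishes almost everywhere
(`VolumeMVP.ae_spherical`).

Conversely, integrating the weak property against a radial weight gives `∫ u(pq) w(N q) dq = u(p) ∫
w(N q) dq` (`IsPolarMeasure.integral_mul_radial_eq`). An indicator weight yields the volume
property. The profile of `ψ_ε` yields `u * ψ_ε = u`, since `N` is symmetric
(`conv_rescale_bump_eq`). Convolution with a smooth compactly supported function is smooth
(`contDiff_conv`), so `u` is smooth, and continuity in `r` upgrades almost every radius to every
radius (`sphericalMVP_of_ae_spherical`).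

Polar coordinates around every point need two facts about Lebesgue measure: it scales by `r^Q` under
`δ_r` (`det_dilation`) and is left invariant (`isMulLeftInvariant`). -/

namespace Stratification

/-! ### Dilations in a basis adapted to the layers. -/

variable {G : Type*} [NormedAddCommGroup G] [NormedSpace ℝ G] [Group G]

theorem proj_of_mem (S : Stratification G) {i : ℕ} {x : G} (hx : x ∈ S.layer i) :
    S.proj i x = x :=
  congrArg Subtype.val (S.isInternal.ofBijective_coeLinearMap_of_mem hx)

theorem proj_of_mem_ne (S : Stratification G) {i j : ℕ} (hij : i ≠ j) {x : G}
    (hx : x ∈ S.layer i) : S.proj j x = 0 :=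
  congrArg Subtype.val (S.isInternal.ofBijective_coeLinearMap_of_mem_ne hij hx)

theorem mem_Icc_of_layer_ne_bot (S : Stratification G) {i : ℕ} (h : S.layer i ≠ ⊥) :
    i ∈ Finset.Icc 1 S.step := by
  rw [Finset.mem_Icc]
  refine ⟨Nat.one_le_iff_ne_zero.2 fun h0 => h (h0 ▸ S.layer_zero), ?_⟩
  by_contra h1
  exact h (S.layer_of_step_lt i (not_le.1 h1))

theorem dilation_of_mem (S : Stratification G) (r : ℝ) {i : ℕ} {x : G} (hx : x ∈ S.layer i) :
    S.dilation r x = r ^ i • x := by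
  rcases eq_or_ne x 0 with rfl | h0
  · simp
  have hi : i ∈ Finset.Icc 1 S.step :=
    S.mem_Icc_of_layer_ne_bot fun h => h0 (by rw [h] at hx; simpa using hx)
  rw [dilation, LinearMap.sum_apply, Finset.sum_eq_single_of_mem i hi]
  · simp [S.proj_of_mem hx]
  · intro j _ hj
    simp [S.proj_of_mem_ne hj.symm hx]

theorem index_mem_Icc (S : Stratification G) (x : Σ i, Fin (Module.finrank ℝ (S.layer i))) :
    x.1 ∈ Finset.Icc 1 S.step := by
  refine S.mem_Icc_of_layer_ne_bot fun h => ?_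
  have h1 : Module.finrank ℝ (S.layer x.1) = 0 := by rw [h]; simp
  exact (Fin.cast h1 x.2).elim0

/-- A basis of `G` consisting of elements of the layers. -/
noncomputable def adaptedBasis [FiniteDimensional ℝ G] (S : Stratification G) :
    Module.Basis (Σ i, Fin (Module.finrank ℝ (S.layer i))) ℝ G :=
  S.isInternal.collectedBasis fun i => Module.finBasis ℝ (S.layer i)

variable [FiniteDimensional ℝ G]

theorem dilation_adaptedBasis (S : Stratification G) (r : ℝ)
    (x : Σ i, Fin (Module.finrank ℝ (S.layer i))) :
    S.dilation r (S.adaptedBasis x) = r ^ x.1 • S.adaptedBasis x :=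
  S.dilation_of_mem r (S.isInternal.collectedBasis_mem _ x)

theorem dilation_one (S : Stratification G) : S.dilation 1 = LinearMap.id :=
  S.adaptedBasis.ext fun x => by simp [dilation_adaptedBasis]

theorem dilation_one_apply (S : Stratification G) (x : G) : S.dilation 1 x = x := by
  simp [dilation_one]

theorem dilation_dilation (S : Stratification G) (a b : ℝ) (x : G) :
    S.dilation a (S.dilation b x) = S.dilation (a * b) x := by
  have : S.dilation a ∘ₗ S.dilation b = S.dilation (a * b) :=
    S.adaptedBasis.ext fun x => by simp [dilation_adaptedBasis, smul_smul, mul_pow, mul_comm]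
  exact LinearMap.congr_fun this x

theorem dilation_inv_dilation (S : Stratification G) {r : ℝ} (hr : 0 < r) (x : G) :
    S.dilation r⁻¹ (S.dilation r x) = x := by
  rw [dilation_dilation, inv_mul_cancel₀ hr.ne', dilation_one_apply]

theorem dilation_dilation_inv (S : Stratification G) {r : ℝ} (hr : 0 < r) (x : G) :
    S.dilation r (S.dilation r⁻¹ x) = x := by
  rw [dilation_dilation, mul_inv_cancel₀ hr.ne', dilation_one_apply]

theorem dilation_zero (S : Stratification G) : S.dilation 0 = 0 :=
  S.adaptedBasis.ext fun x => by
    have := Finset.mem_Icc.1 (S.index_mem_Icc x)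
    rw [dilation_adaptedBasis, zero_pow (by omega)]
    simp

theorem continuous_dilation (S : Stratification G) :
    Continuous fun x : ℝ × G => S.dilation x.1 x.2 := by
  simp only [dilation, LinearMap.sum_apply, LinearMap.smul_apply]
  refine continuous_finsetSum _ fun i _ => ?_
  exact (continuous_fst.pow i).smul
    ((LinearMap.continuous_of_finiteDimensional (S.proj i)).comp continuous_snd)

/-- In the adapted basis the dilation is diagonal, with `r ^ i` repeated `dim 𝔤ᵢ` times. -/
theorem det_dilation (S : Stratification G) (r : ℝ) :
    LinearMap.det (S.dilation r) = r ^ S.homDim := by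
  classical
  let _ : Fintype (Σ i, Fin (Module.finrank ℝ (S.layer i))) :=
    FiniteDimensional.fintypeBasisIndex S.adaptedBasis
  have h : LinearMap.toMatrix S.adaptedBasis S.adaptedBasis (S.dilation r) =
      Matrix.diagonal fun x => r ^ x.1 := by
    ext x y
    rw [LinearMap.toMatrix_apply, dilation_adaptedBasis]
    by_cases hxy : x = y
    · subst hxy; simp
    · simp [hxy]
  rw [← LinearMap.det_toMatrix S.adaptedBasis, h, Matrix.det_diagonal, Finset.prod_pow_eq_pow_sum]
  congr 1
  -- Only layers `1, …, s` contribute basis vectors, although the index runs over all of `ℕ`.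
  have hu : (Finset.univ : Finset (Σ i, Fin (Module.finrank ℝ (S.layer i)))) =
      (Finset.Icc 1 S.step).sigma fun _ => Finset.univ := by
    ext x
    simpa using Finset.mem_Icc.1 (S.index_mem_Icc x)
  rw [hu, Finset.sum_sigma, homDim]
  simp [mul_comm]

theorem homDim_pos [Nontrivial G] (S : Stratification G) : 0 < S.homDim := by
  obtain ⟨x⟩ := S.adaptedBasis.index_nonempty
  have hx := S.index_mem_Icc x
  refine Finset.sum_pos' (fun _ _ => Nat.zero_le _)
    ⟨x.1, hx, Nat.mul_pos (Finset.mem_Icc.1 hx).1 ?_⟩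
  exact (Nat.zero_le _).trans_lt x.2.2

theorem addHaar_preimage_dilation [MeasurableSpace G] [BorelSpace G] (S : Stratification G)
    (μ : Measure G) [μ.IsAddHaarMeasure] {r : ℝ} (hr : 0 < r) (s : Set G) :
    μ (S.dilation r⁻¹ ⁻¹' s) = ENNReal.ofReal (r ^ S.homDim) * μ s := by
  have hr' : r⁻¹ ^ S.homDim ≠ 0 := pow_ne_zero _ (inv_pos.2 hr).ne'
  rw [Measure.addHaar_preimage_linearMap μ (by rwa [det_dilation]), det_dilation, inv_pow,
    inv_inv, abs_of_pos (pow_pos hr _)]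

end Stratification

/-! ### Left invariance of Lebesgue measure. -/

namespace CarnotStructure

variable {G : Type*} [NormedAddCommGroup G] [NormedSpace ℝ G] [Group G]

theorem contDiff_mul [LieGroup 𝓘(ℝ, G) ∞ G] : ContDiff ℝ ∞ fun x : G × G => x.1 * x.2 := by
  have h := _root_.contMDiff_mul 𝓘(ℝ, G) ∞ (G := G)
  -- This identifies the product manifold structure with that of the vector space `G × G`, turning
  -- manifold smoothness into ordinary smoothness.
  rw [← modelWithCornersSelf_prod, chartedSpaceSelf_prod] at h
  exact contMDiff_iff_contDiff.1 h

theorem contDiff_inv [LieGroup 𝓘(ℝ, G) ∞ G] : ContDiff ℝ ∞ fun x : G => x⁻¹ :=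
  contMDiff_iff_contDiff.1 (_root_.contMDiff_inv 𝓘(ℝ, G) ∞ (G := G))

variable [LieGroup 𝓘(ℝ, G) ∞ G]

theorem contDiff_mul_left (p : G) : ContDiff ℝ ∞ fun q : G => p * q :=
  contDiff_mul.comp (contDiff_const.prodMk contDiff_id)

theorem differentiable_mul_left (p : G) : Differentiable ℝ fun q : G => p * q :=
  (contDiff_mul_left p).differentiable (by simp)

theorem continuous_det_fderiv_mul_left :
    Continuous fun p : G => (fderiv ℝ (fun q : G => p * q) 0).det := by
  refine ContinuousLinearMap.continuous_det.comp ?_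
  have h : ContDiff ℝ ∞ (Function.uncurry fun p q : G => p * q) := contDiff_mul
  exact (ContDiff.fderiv (m := ∞) (n := 0) h contDiff_const (by simp)).continuous

variable [FiniteDimensional ℝ G]

/-- Since `δ_r` is an automorphism, it conjugates translation by `p` to translation by `δ_r p`; it
is linear and fixes `0`, so its determinant cancels. -/
theorem det_fderiv_dilation_mul_left (S : CarnotStructure G) {r : ℝ} (hr : 0 < r) (p : G) :
    (fderiv ℝ (fun q : G => S.dilation r p * q) 0).det =
      (fderiv ℝ (fun q : G => p * q) 0).det := by
  let D : G →L[ℝ] G := LinearMap.toContinuousLinearMap (S.dilation r)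
  have h : (fun q : G => S.dilation r p * q) ∘ D = D ∘ fun q : G => p * q := by
    ext q
    exact (S.dilation_mul r hr p q).symm
  have h1 := congrArg (fun f => fderiv ℝ f 0) h
  rw [fderiv_comp _ (differentiable_mul_left _ _) D.differentiableAt,
    fderiv_comp _ D.differentiableAt (differentiable_mul_left _ _)] at h1
  simp only [ContinuousLinearMap.fderiv, map_zero] at h1
  have h2 := congrArg (fun f : G →L[ℝ] G => LinearMap.det (f : G →ₗ[ℝ] G)) h1
  simp only [ContinuousLinearMap.toLinearMap_comp, LinearMap.det_comp] at h2
  have hD : LinearMap.det (D : G →ₗ[ℝ] G) ≠ 0 := by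
    have : (D : G →ₗ[ℝ] G) = S.dilation r := rfl
    rw [this, S.det_dilation]
    exact (pow_pos hr _).ne'
  rw [mul_comm] at h2
  exact mul_left_cancel₀ hD h2

/-- The Jacobian is constant along `δ_r p` for `r > 0` and continuous in `r`. As `r → 0` the
translation tends to that by `0 = 1`, the identity map. -/
theorem det_fderiv_mul_left_zero (S : CarnotStructure G) (p : G) :
    (fderiv ℝ (fun q : G => p * q) 0).det = 1 := by
  have hc : Continuous fun r : ℝ => (fderiv ℝ (fun q : G => S.dilation r p * q) 0).det :=
    continuous_det_fderiv_mul_left.comp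
      (S.continuous_dilation.comp (continuous_id.prodMk continuous_const))
  have h0 : Filter.Tendsto (fun r : ℝ => (fderiv ℝ (fun q : G => S.dilation r p * q) 0).det)
      (nhdsWithin 0 (Set.Ioi 0)) (nhds (fderiv ℝ (fun q : G => S.dilation 0 p * q) 0).det) :=
    (hc.tendsto 0).mono_left nhdsWithin_le_nhds
  have h1 : Filter.Tendsto (fun r : ℝ => (fderiv ℝ (fun q : G => S.dilation r p * q) 0).det)
      (nhdsWithin 0 (Set.Ioi 0)) (nhds (fderiv ℝ (fun q : G => p * q) 0).det) := by
    refine tendsto_const_nhds.congr' ?_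
    filter_upwards [self_mem_nhdsWithin] with r hr
    exact (S.det_fderiv_dilation_mul_left hr p).symm
  rw [tendsto_nhds_unique h1 h0]
  have : (fun q : G => S.dilation 0 p * q) = id := by
    ext q
    simp [S.dilation_zero, ← S.one_eq_zero]
  rw [this, fderiv_id]
  exact LinearMap.det_id

/-- Chain rule at `0` for the composite of the translations by `q` and by `p`, which is translation
by `p * q`. -/
theorem det_fderiv_mul_left (S : CarnotStructure G) (p q : G) :
    (fderiv ℝ (fun q : G => p * q) q).det = 1 := by
  have h : (fun x : G => p * x) ∘ (fun x : G => q * x) = fun x : G => p * q * x := by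
    ext x
    simp [mul_assoc]
  have h1 := congrArg (fun f => fderiv ℝ f 0) h
  rw [fderiv_comp _ (differentiable_mul_left _ _) (differentiable_mul_left _ _),
    ← S.one_eq_zero, mul_one, S.one_eq_zero] at h1
  have h2 := congrArg (fun f : G →L[ℝ] G => LinearMap.det (f : G →ₗ[ℝ] G)) h1
  simp only [ContinuousLinearMap.toLinearMap_comp, LinearMap.det_comp] at h2
  have h3 := S.det_fderiv_mul_left_zero q
  have h4 := S.det_fderiv_mul_left_zero (p * q)
  simp only [ContinuousLinearMap.det] at h3 h4 ⊢
  rw [h3, h4, mul_one] at h2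
  exact h2

variable [MeasurableSpace G] [BorelSpace G]

theorem addHaar_image_mul_left (S : CarnotStructure G) (μ : Measure G) [μ.IsAddHaarMeasure]
    (p : G) {s : Set G} (hs : MeasurableSet s) : μ ((fun q => p * q) '' s) = μ s := by
  rw [← lintegral_abs_det_fderiv_eq_addHaar_image μ hs
    (fun x _ => (differentiable_mul_left p x).hasFDerivAt.hasFDerivWithinAt)
    (mul_right_injective p).injOn]
  simp [S.det_fderiv_mul_left]

theorem isMulLeftInvariant (S : CarnotStructure G) (μ : Measure G) [μ.IsAddHaarMeasure] :
    μ.IsMulLeftInvariant := by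
  refine ⟨fun p => ?_⟩
  ext s hs
  have hm : Measurable fun q : G => p * q := (contDiff_mul_left p).continuous.measurable
  rw [Measure.map_apply hm hs, ← S.addHaar_image_mul_left μ p (hm hs), Set.image_preimage_eq]
  exact (Group.mulLeft_bijective p).2


variable {G : Type*} [NormedAddCommGroup G] [NormedSpace ℝ G] [Group G]

/-! ### Compactness of pseudonorm balls and of the unit sphere. -/

section Pseudonorm

variable {S : CarnotStructure G} {N : G → ℝ}

theorem IsPseudonorm.map_zero (hN : S.IsPseudonorm N) : N 0 = 0 :=
  le_antisymm (not_lt.1 fun h => (hN.pos_iff 0).1 h rfl) (hN.nonneg 0)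

theorem IsPseudonorm.dilation_inv_mem_unitSphere (hN : S.IsPseudonorm N) {q : G} (hq : q ≠ 0) :
    S.dilation (N q)⁻¹ q ∈ unitSphere N := by
  have h := (hN.pos_iff q).2 hq
  rw [unitSphere, Set.mem_ofPred_eq, hN.homogeneous _ (inv_pos.2 h), inv_mul_cancel₀ h.ne']

theorem IsPseudonorm.dilation_mem_unitSphere (hN : S.IsPseudonorm N) {r : ℝ} (hr : 0 < r)
    {v : G} (hv : v ∈ unitSphere N) : N (S.dilation r v) = r := by
  rw [hN.homogeneous r hr, show N v = 1 from hv, mul_one]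

theorem IsPseudonorm.unitSphere_nonempty [Nontrivial G] (hN : S.IsPseudonorm N) :
    (unitSphere N).Nonempty := by
  obtain ⟨q, hq⟩ := exists_ne (0 : G)
  exact ⟨_, hN.dilation_inv_mem_unitSphere hq⟩

variable [FiniteDimensional ℝ G]

/-- Take for `m` a positive lower bound of `N` on the Euclidean unit sphere. If `‖q‖ ≥ 1`, the curve
`t ↦ δ_t q` on `[0, 1]` starts at `0` and meets that sphere at some `t ≤ 1`, so `m ≤ t N(q) ≤ N(q)`.
-/
theorem IsPseudonorm.exists_lt_norm_lt_one (hN : S.IsPseudonorm N) :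
    ∃ m : ℝ, 0 < m ∧ ∀ q, N q < m → ‖q‖ < 1 := by
  obtain ⟨m, hm, hle⟩ : ∃ m : ℝ, 0 < m ∧ ∀ q, ‖q‖ = 1 → m ≤ N q := by
    have hc : IsCompact (Metric.sphere (0 : G) 1) := isCompact_sphere 0 1
    rcases (Metric.sphere (0 : G) 1).eq_empty_or_nonempty with he | hne
    · refine ⟨1, one_pos, fun q hq => ?_⟩
      have : q ∈ Metric.sphere (0 : G) 1 := by simpa using hq
      simp [he] at this
    · obtain ⟨x, hx, hmin⟩ := hc.exists_isMinOn hne hN.continuous.continuousOn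
      refine ⟨N x, (hN.pos_iff x).2 ?_, fun q hq => hmin (by simpa using hq)⟩
      rintro rfl
      simp at hx
  refine ⟨m, hm, fun q hq => ?_⟩
  by_contra! h
  have hc : ContinuousOn (fun t : ℝ => ‖S.dilation t q‖) (Set.Icc 0 1) :=
    (S.continuous_dilation.comp (continuous_id.prodMk continuous_const)).norm.continuousOn
  obtain ⟨t, ht, h1⟩ := intermediate_value_Icc zero_le_one hc
    (show (1 : ℝ) ∈ Set.Icc ‖S.dilation 0 q‖ ‖S.dilation 1 q‖ by
      simpa [S.dilation_zero, S.dilation_one] using h)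
  have h1 : ‖S.dilation t q‖ = 1 := h1
  have ht0 : 0 < t := ht.1.lt_of_ne' fun h0 => by
    rw [h0, S.dilation_zero] at h1
    simp at h1
  have h2 := hle _ h1
  rw [hN.homogeneous t ht0] at h2
  nlinarith [mul_le_of_le_one_left (hN.nonneg q) ht.2]

theorem IsPseudonorm.isCompact_le (hN : S.IsPseudonorm N) (R : ℝ) : IsCompact {q | N q ≤ R} := by
  obtain ⟨m, hm, hlt⟩ := hN.exists_lt_norm_lt_one
  -- Dilating by this factor sends `{N ≤ R}` into `{N < m}`, hence into the Euclidean unit ball; the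
  -- `+ 1` makes the inequality strict.
  have hr : 0 < m / (|R| + 1) := by positivity
  have hK : IsCompact (S.dilation (m / (|R| + 1))⁻¹ '' Metric.closedBall (0 : G) 1) :=
    (isCompact_closedBall 0 1).image (S.dilation _).continuous_of_finiteDimensional
  refine hK.of_isClosed_subset (isClosed_le hN.continuous continuous_const) fun q hq => ?_
  refine ⟨S.dilation (m / (|R| + 1)) q, ?_, S.dilation_inv_dilation hr q⟩
  rw [mem_closedBall_zero_iff]
  refine (hlt _ ?_).le
  have hq : N q ≤ R := hq
  rw [hN.homogeneous _ hr, div_mul_eq_mul_div, div_lt_iff₀ (by positivity)]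
  exact mul_lt_mul_of_pos_left (by linarith [le_abs_self R]) hm

theorem IsPseudonorm.isCompact_unitSphere (hN : S.IsPseudonorm N) : IsCompact (unitSphere N) :=
  (hN.isCompact_le 1).of_isClosed_subset (isClosed_eq hN.continuous continuous_const)
    fun _ hq => le_of_eq hq

end Pseudonorm

/-! ### The radial measure and its values on half lines. -/

section RadialMeasure

/-- The measure `r^{Q-1} dr` on `(0, ∞)`. -/
noncomputable def radialMeasure (S : CarnotStructure G) : Measure ℝ :=
  (volume.restrict (Set.Ioi 0)).withDensity fun r => ENNReal.ofReal (r ^ (S.homDim - 1))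

instance (S : CarnotStructure G) : SigmaFinite S.radialMeasure :=
  SigmaFinite.withDensity_ofReal _

theorem ae_radialMeasure_pos (S : CarnotStructure G) : ∀ᵐ r ∂S.radialMeasure, 0 < r :=
  (withDensity_absolutelyContinuous _ _).ae_le (ae_restrict_mem measurableSet_Ioi)

theorem radialMeasure_Iic_of_nonpos (S : CarnotStructure G) {b : ℝ} (hb : b ≤ 0) :
    S.radialMeasure (Set.Iic b) = 0 := by
  refine measure_mono_null (fun r hr => ?_) S.ae_radialMeasure_pos
  exact not_lt.2 (le_trans hr hb)

variable [FiniteDimensional ℝ G] [Nontrivial G]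

theorem radialMeasure_Iic (S : CarnotStructure G) {b : ℝ} (hb : 0 ≤ b) :
    S.radialMeasure (Set.Iic b) = ENNReal.ofReal (b ^ S.homDim / S.homDim) := by
  have hQ : S.homDim - 1 + 1 = S.homDim := Nat.sub_add_cancel S.homDim_pos
  rw [radialMeasure, withDensity_apply _ measurableSet_Iic, Measure.restrict_restrict
    measurableSet_Iic, Set.Iic_inter_Ioi, ← ofReal_integral_eq_lintegral_ofReal]
  · rw [← intervalIntegral.integral_of_le hb, integral_pow, ← Nat.cast_succ, Nat.succ_eq_add_one,
      hQ, zero_pow S.homDim_pos.ne', sub_zero]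
  · exact ((continuous_pow _).integrableOn_Icc).mono_set Set.Ioc_subset_Icc_self
  · filter_upwards [ae_restrict_mem measurableSet_Ioc] with r hr
    exact pow_nonneg hr.1.le _

theorem radialMeasure_Iic_lt_top (S : CarnotStructure G) (b : ℝ) :
    S.radialMeasure (Set.Iic b) < ⊤ := by
  refine (measure_mono (Set.Iic_subset_Iic.2 (le_max_left b 0))).trans_lt ?_
  rw [S.radialMeasure_Iic (le_max_right b 0)]
  exact ENNReal.ofReal_lt_top

end RadialMeasure

/-- Two measures on `ℝ` which agree on the half lines `Iic b` and are finite there are equal. -/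
theorem measure_ext_of_Iic {α β : Measure ℝ} (h : ∀ b, α (Set.Iic b) = β (Set.Iic b))
    (hα : ∀ b, α (Set.Iic b) ≠ ⊤) : α = β := by
  refine Measure.ext_of_generateFrom_of_iUnion (Set.range Set.Iic) (fun n : ℕ => Set.Iic (n : ℝ))
    ?_ isPiSystem_Iic ?_ (fun n => ⟨_, rfl⟩) (fun n => hα _) ?_
  · rw [BorelSpace.measurable_eq (α := ℝ), borel_eq_generateFrom_Iic]
  · refine Set.eq_univ_of_forall fun x => Set.mem_iUnion.2 ?_
    exact exists_nat_ge x
  · rintro _ ⟨b, rfl⟩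
    exact h b


/-! ### Polar coordinates: existence and uniqueness of the polar measure. -/

variable {G : Type*} [NormedAddCommGroup G] [NormedSpace ℝ G] [Group G]

/-- Polar coordinates `(r, v) ↦ δ_r v`. -/
noncomputable def polarMap (S : CarnotStructure G) (N : G → ℝ) (z : ℝ × unitSphere N) : G :=
  S.dilation z.1 z.2

open Classical in
/-- The projection `q ↦ δ_{1 / N q} q` of `G` onto the unit sphere, with an arbitrary value at the
origin. -/
noncomputable def sphereProj (S : CarnotStructure G) {N : G → ℝ} (hN : S.IsPseudonorm N)
    (v₀ : unitSphere N) (q : G) : unitSphere N :=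
  ⟨if q = 0 then v₀ else S.dilation (N q)⁻¹ q, by
    split_ifs with h
    · exact v₀.2
    · exact hN.dilation_inv_mem_unitSphere h⟩

variable {S : CarnotStructure G} {N : G → ℝ}

theorem polarMap_sphereProj (hN : S.IsPseudonorm N) [FiniteDimensional ℝ G] (v₀ : unitSphere N)
    {q : G} (hq : q ≠ 0) : S.polarMap N (N q, S.sphereProj hN v₀ q) = q := by
  simp only [polarMap, sphereProj, if_neg hq]
  exact S.dilation_dilation_inv ((hN.pos_iff q).2 hq) q

theorem polarMap_ne_zero (hN : S.IsPseudonorm N) {r : ℝ} (hr : 0 < r)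
    (v : unitSphere N) : S.polarMap N (r, v) ≠ 0 :=
  (hN.pos_iff _).1 (by rw [polarMap, hN.dilation_mem_unitSphere hr v.2]; exact hr)

theorem sphereProj_polarMap (hN : S.IsPseudonorm N) [FiniteDimensional ℝ G] (v₀ : unitSphere N)
    {r : ℝ} (hr : 0 < r) (v : unitSphere N) :
    S.sphereProj hN v₀ (S.polarMap N (r, v)) = v := by
  refine Subtype.ext ?_
  simp only [sphereProj, if_neg (polarMap_ne_zero hN hr v)]
  rw [polarMap, hN.dilation_mem_unitSphere hr v.2]
  exact S.dilation_inv_dilation hr _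

theorem sphereProj_dilation (hN : S.IsPseudonorm N) [FiniteDimensional ℝ G] (v₀ : unitSphere N)
    {r : ℝ} (hr : 0 < r) {q : G} (hq : q ≠ 0) :
    S.sphereProj hN v₀ (S.dilation r q) = S.sphereProj hN v₀ q := by
  have hpos := (hN.pos_iff q).2 hq
  have h : S.dilation r q = S.polarMap N (r * N q, S.sphereProj hN v₀ q) := by
    conv_lhs => rw [← polarMap_sphereProj hN v₀ hq]
    simp only [polarMap]
    rw [S.dilation_dilation]
  rw [h, sphereProj_polarMap hN v₀ (mul_pos hr hpos)]

variable [FiniteDimensional ℝ G]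

theorem continuous_polarMap : Continuous (S.polarMap N) :=
  S.continuous_dilation.comp (continuous_fst.prodMk (continuous_subtype_val.comp continuous_snd))

variable [MeasurableSpace G]

theorem IsPolarMeasure.isFiniteMeasure {μ : Measure G} {σ : Measure (unitSphere N)}
    (hσ : S.IsPolarMeasure μ N σ) (hN : S.IsPseudonorm N) : IsFiniteMeasure σ := by
  have := isCompact_iff_compactSpace.1 hN.isCompact_unitSphere
  have := hσ.radon
  infer_instance

/-- The polar measure, given by the volumes of cones. -/
noncomputable def coneMeasure (μ : Measure G) (hN : S.IsPseudonorm N) (v₀ : unitSphere N) :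
    Measure (unitSphere N) :=
  (S.homDim : ENNReal) • (μ.restrict ({0}ᶜ ∩ {q | N q ≤ 1})).map (S.sphereProj hN v₀)

theorem isFiniteMeasure_coneMeasure (μ : Measure G) [μ.IsAddHaarMeasure]
    (hN : S.IsPseudonorm N) (v₀ : unitSphere N) :
    IsFiniteMeasure (coneMeasure μ hN v₀) := by
  have h : IsFiniteMeasure (μ.restrict ({0}ᶜ ∩ {q | N q ≤ 1})) := by
    rw [isFiniteMeasure_restrict]
    exact ((measure_mono Set.inter_subset_right).trans_lt
      (hN.isCompact_le 1).measure_lt_top).ne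
  refine ⟨?_⟩
  rw [coneMeasure, Measure.smul_apply, smul_eq_mul]
  exact ENNReal.mul_lt_top (ENNReal.natCast_lt_top _) (measure_lt_top _ _)

variable [BorelSpace G]

theorem measurable_polarMap : Measurable (S.polarMap N) :=
  continuous_polarMap.measurable

theorem measurable_sphereProj (hN : S.IsPseudonorm N) (v₀ : unitSphere N) :
    Measurable (S.sphereProj hN v₀) := by
  refine Measurable.subtype_mk (Measurable.ite (measurableSet_singleton 0) measurable_const ?_)
  exact S.continuous_dilation.measurable.comp
    (hN.continuous.measurable.inv.prodMk measurable_id)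

theorem lintegral_polarMap {σ : Measure (unitSphere N)} [SFinite σ] {f : G → ENNReal}
    (hf : Measurable f) :
    ∫⁻ z, f (S.polarMap N z) ∂(S.radialMeasure.prod σ) =
      ∫⁻ r in Set.Ioi (0 : ℝ), ∫⁻ v : unitSphere N,
        f (S.dilation r v) * ENNReal.ofReal (r ^ (S.homDim - 1)) ∂σ := by
  have hm : Measurable fun z : ℝ × unitSphere N => f (S.polarMap N z) :=
    hf.comp measurable_polarMap
  rw [lintegral_prod _ hm.aemeasurable, radialMeasure, lintegral_withDensity_eq_lintegral_mul _
    (by fun_prop) hm.lintegral_prod_right']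
  refine lintegral_congr fun r => ?_
  rw [Pi.mul_apply, mul_comm, ← lintegral_mul_const]
  · rfl
  · exact hm.comp measurable_prodMk_left

theorem IsPolarMeasure.measurePreserving {μ : Measure G} {σ : Measure (unitSphere N)}
    [IsFiniteMeasure σ] (hσ : S.IsPolarMeasure μ N σ) :
    MeasurePreserving (S.polarMap N) (S.radialMeasure.prod σ) μ := by
  refine ⟨measurable_polarMap, ?_⟩
  ext s hs
  have h := hσ.polar (s.indicator 1) (measurable_one.indicator hs)
  rw [← lintegral_polarMap (measurable_one.indicator hs), lintegral_indicator_one hs] at h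
  rw [Measure.map_apply measurable_polarMap hs, h,
    ← lintegral_indicator_one (measurable_polarMap hs)]
  rfl

theorem isPolarMeasure_of_measurePreserving {μ : Measure G} {σ : Measure (unitSphere N)}
    [IsFiniteMeasure σ] (hN : S.IsPseudonorm N)
    (h : MeasurePreserving (S.polarMap N) (S.radialMeasure.prod σ) μ) :
    S.IsPolarMeasure μ N σ where
  radon := by
    have := isCompact_iff_compactSpace.1 hN.isCompact_unitSphere
    infer_instance
  polar f hf := by rw [← lintegral_polarMap hf, h.lintegral_comp hf]

variable [Nontrivial G]

/-- A polar measure is determined by the volumes of cones: the part of the unit ball lying over `E`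
has volume `1 / Q` times the measure of `E`. -/
theorem IsPolarMeasure.unique {μ : Measure G} (hN : S.IsPseudonorm N)
    {σ τ : Measure (unitSphere N)} (hσ : S.IsPolarMeasure μ N σ) (hτ : S.IsPolarMeasure μ N τ) :
    σ = τ := by
  have v₀ : unitSphere N := ⟨hN.unitSphere_nonempty.some, hN.unitSphere_nonempty.some_mem⟩
  have key : ∀ ρ : Measure (unitSphere N), S.IsPolarMeasure μ N ρ → ∀ E, MeasurableSet E →
      μ {q | S.sphereProj hN v₀ q ∈ E ∧ N q ≤ 1} = S.radialMeasure (Set.Iic 1) * ρ E := by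
    intro ρ hρ E hE
    have := hρ.isFiniteMeasure hN
    have hA : MeasurableSet {q | S.sphereProj hN v₀ q ∈ E ∧ N q ≤ 1} :=
      (measurable_sphereProj hN v₀ hE).inter (hN.continuous.measurable measurableSet_Iic)
    rw [← hρ.measurePreserving.measure_preimage hA.nullMeasurableSet, ← Measure.prod_prod]
    refine measure_congr ?_
    have hpos : ∀ᵐ z ∂(S.radialMeasure.prod ρ), 0 < z.1 :=
      Measure.quasiMeasurePreserving_fst.ae S.ae_radialMeasure_pos
    filter_upwards [hpos] with ⟨r, v⟩ hr
    refine propext ?_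
    change (S.sphereProj hN v₀ (S.polarMap N (r, v)) ∈ E ∧ N (S.polarMap N (r, v)) ≤ 1) ↔
      (r ≤ 1 ∧ v ∈ E)
    rw [sphereProj_polarMap hN v₀ hr, polarMap, hN.dilation_mem_unitSphere hr v.2, and_comm]
  ext E hE
  have h := (key σ hσ E hE).symm.trans (key τ hτ E hE)
  refine (ENNReal.mul_right_inj ?_ (S.radialMeasure_Iic_lt_top 1).ne).1 h
  have hQ := S.homDim_pos
  rw [S.radialMeasure_Iic zero_le_one]
  positivity

variable (μ : Measure G) [μ.IsAddHaarMeasure]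

/-- The cone over `E` truncated at `N ≤ b` is the `δ_b` image of the cone truncated at `N ≤ 1`, so
its volume is `b^Q` times as large. Half lines determine the measure. -/
theorem map_restrict_sphereProj (hN : S.IsPseudonorm N) (v₀ : unitSphere N)
    {E : Set (unitSphere N)} (hE : MeasurableSet E) :
    (μ.restrict ({0}ᶜ ∩ S.sphereProj hN v₀ ⁻¹' E)).map N =
      coneMeasure μ hN v₀ E • S.radialMeasure := by
  have hsph := measurable_sphereProj hN v₀ hE
  have hval : ∀ b, (μ.restrict ({0}ᶜ ∩ S.sphereProj hN v₀ ⁻¹' E)).map N (Set.Iic b) =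
      μ ({q | N q ≤ b} ∩ ({0}ᶜ ∩ S.sphereProj hN v₀ ⁻¹' E)) := fun b => by
    rw [Measure.map_apply hN.continuous.measurable measurableSet_Iic,
      Measure.restrict_apply (hN.continuous.measurable measurableSet_Iic)]
    rfl
  refine measure_ext_of_Iic (fun b => ?_) (fun b => ?_)
  · rw [hval, Measure.smul_apply, smul_eq_mul]
    rcases le_or_gt b 0 with hb | hb
    · rw [radialMeasure_Iic_of_nonpos S hb, mul_zero]
      convert measure_empty (μ := μ)
      refine Set.eq_empty_of_forall_notMem fun q hq => ?_
      exact absurd ((hN.pos_iff q).2 hq.2.1) (not_lt.2 (le_trans hq.1 hb))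
    · have hcone : {q | N q ≤ b} ∩ ({0}ᶜ ∩ S.sphereProj hN v₀ ⁻¹' E) = S.dilation b⁻¹ ⁻¹'
          ({q | N q ≤ 1} ∩ ({0}ᶜ ∩ S.sphereProj hN v₀ ⁻¹' E)) := by
        ext q
        have hb' := inv_pos.2 hb
        have h0 : S.dilation b⁻¹ q = 0 ↔ q = 0 := by
          refine ⟨fun h => ?_, fun h => by rw [h, map_zero]⟩
          rw [← S.dilation_dilation_inv hb q, h, map_zero]
        have h1 : N (S.dilation b⁻¹ q) ≤ 1 ↔ N q ≤ b := by
          rw [hN.homogeneous _ hb', inv_mul_le_iff₀ hb, mul_one]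
        change (N q ≤ b ∧ q ≠ 0 ∧ S.sphereProj hN v₀ q ∈ E) ↔
          (N (S.dilation b⁻¹ q) ≤ 1 ∧ S.dilation b⁻¹ q ≠ 0 ∧
            S.sphereProj hN v₀ (S.dilation b⁻¹ q) ∈ E)
        rw [h1, Ne, Ne, h0]
        refine and_congr_right fun _ => and_congr_right fun hq => ?_
        rw [sphereProj_dilation hN v₀ hb' hq]
      have hQ : (0 : ℝ) < S.homDim := Nat.cast_pos.2 S.homDim_pos
      -- The factor `Q` in `coneMeasure` cancels the denominator of `b^Q / Q`.
      rw [hcone, S.addHaar_preimage_dilation μ hb, S.radialMeasure_Iic hb.le, coneMeasure,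
        Measure.smul_apply, smul_eq_mul, Measure.map_apply (measurable_sphereProj hN v₀) hE,
        Measure.restrict_apply hsph, ENNReal.ofReal_div_of_pos hQ, ENNReal.ofReal_natCast,
        mul_comm (S.homDim : ENNReal), mul_assoc, ENNReal.mul_div_cancel, mul_comm]
      · congr 2
        ext q
        simp only [Set.mem_inter_iff]
        tauto
      · exact_mod_cast S.homDim_pos.ne'
      · exact ENNReal.natCast_ne_top _
  · rw [hval]
    exact ((measure_mono Set.inter_subset_left).trans_lt
      (hN.isCompact_le b).measure_lt_top).ne

theorem isPolarMeasure_coneMeasure (hN : S.IsPseudonorm N) (v₀ : unitSphere N) :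
    S.IsPolarMeasure μ N (coneMeasure μ hN v₀) := by
  have := isFiniteMeasure_coneMeasure μ hN v₀
  refine isPolarMeasure_of_measurePreserving hN ⟨measurable_polarMap, ?_⟩
  have hm : Measurable fun q => (N q, S.sphereProj hN v₀ q) :=
    hN.continuous.measurable.prodMk (measurable_sphereProj hN v₀)
  have hne : ∀ᵐ q ∂μ, q ≠ 0 := by
    rw [ae_iff]
    simp
  -- A product measure is determined on rectangles, where the identity is `map_restrict_sphereProj`.
  -- Inverting the coordinates off the null set `{0}` then recovers `μ`.
  have h : S.radialMeasure.prod (coneMeasure μ hN v₀) =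
      μ.map fun q => (N q, S.sphereProj hN v₀ q) := by
    refine Measure.prod_eq fun t E ht hE => ?_
    rw [Measure.map_apply hm (ht.prod hE), mul_comm, ← smul_eq_mul, ← Measure.smul_apply,
      ← map_restrict_sphereProj μ hN v₀ hE, Measure.map_apply hN.continuous.measurable ht,
      Measure.restrict_apply (hN.continuous.measurable ht)]
    refine measure_congr ?_
    filter_upwards [hne] with q hq
    refine propext ?_
    change (N q ∈ t ∧ S.sphereProj hN v₀ q ∈ E) ↔
      (N q ∈ t ∧ q ≠ 0 ∧ S.sphereProj hN v₀ q ∈ E)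
    tauto
  rw [h, Measure.map_map measurable_polarMap hm]
  conv_rhs => rw [← Measure.map_id (μ := μ)]
  refine Measure.map_congr ?_
  filter_upwards [hne] with q hq
  exact polarMap_sphereProj hN v₀ hq

theorem existsUnique_isPolarMeasure (hN : S.IsPseudonorm N) :
    ∃! σ : Measure (unitSphere N), S.IsPolarMeasure μ N σ :=
  ⟨_, isPolarMeasure_coneMeasure μ hN ⟨_, hN.unitSphere_nonempty.some_mem⟩, fun _ hτ =>
    hτ.unique hN (isPolarMeasure_coneMeasure μ hN _)⟩

end CarnotStructure

/-- A function on `ℝ` whose integrals over all half lines `Iic b` vanish is zero almost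
everywhere. -/
theorem ae_eq_zero_of_setIntegral_Iic_eq_zero {ν : Measure ℝ} [SigmaFinite ν] {H : ℝ → ℝ}
    (hint : ∀ b, IntegrableOn H (Set.Iic b) ν) (h0 : ∀ b, ∫ r in Set.Iic b, H r ∂ν = 0) :
    ∀ᵐ r ∂ν, H r = 0 := by
  have hfin : ∀ b, ∫⁻ r in Set.Iic b, ENNReal.ofReal (H r) ∂ν ≠ ⊤ := fun b =>
    ((hint b).lintegral_lt_top).ne
  have hfin' : ∀ b, ∫⁻ r in Set.Iic b, ENNReal.ofReal (-H r) ∂ν ≠ ⊤ := fun b =>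
    ((hint b).neg.lintegral_lt_top).ne
  have hm : AEMeasurable H ν := by
    have hU : ⋃ n : ℕ, Set.Iic (n : ℝ) = Set.univ :=
      Set.eq_univ_of_forall fun x => Set.mem_iUnion.2 (exists_nat_ge x)
    have := (aestronglyMeasurable_iUnion_iff (μ := ν) (s := fun n : ℕ => Set.Iic (n : ℝ))).2
      fun n => (hint n).aestronglyMeasurable
    rw [hU, Measure.restrict_univ] at this
    exact this.aemeasurable
  -- Positive and negative parts of `H` have equal finite integrals over each half line, so they
  -- define the same measure. They therefore agree almost everywhere, and as one of them is always
  -- zero, both vanish.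
  have heq : ν.withDensity (fun r => ENNReal.ofReal (H r)) =
      ν.withDensity (fun r => ENNReal.ofReal (-H r)) := by
    refine CarnotStructure.measure_ext_of_Iic (fun b => ?_) (fun b => ?_)
    · rw [withDensity_apply _ measurableSet_Iic, withDensity_apply _ measurableSet_Iic]
      have := h0 b
      rw [integral_eq_lintegral_pos_part_sub_lintegral_neg_part (hint b), sub_eq_zero] at this
      exact (ENNReal.toReal_eq_toReal_iff' (hfin b) (hfin' b)).1 this
    · rw [withDensity_apply _ measurableSet_Iic]
      exact hfin b
  replace heq := (withDensity_eq_iff_of_sigmaFinite hm.ennreal_ofReal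
    hm.neg.ennreal_ofReal).1 heq
  filter_upwards [heq] with r hr
  rw [Pi.neg_apply] at hr
  rcases le_total 0 (H r) with h | h
  · rw [ENNReal.ofReal_of_nonpos (neg_nonpos.2 h)] at hr
    exact le_antisymm (ENNReal.ofReal_eq_zero.1 hr) h
  · rw [ENNReal.ofReal_of_nonpos h] at hr
    linarith [ENNReal.ofReal_eq_zero.1 hr.symm]

/-! ### Radial weights, and spherical means for almost every radius. -/

namespace CarnotStructure

theorem preimage_pball {G : Type*} [Group G] (N : G → ℝ) (p : G) (R : ℝ) :
    (fun q => p * q) ⁻¹' pball N p R = {q | N q ≤ R} := by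
  ext q
  simp [pball]

variable {G : Type*} [NormedAddCommGroup G] [NormedSpace ℝ G] [Group G]
  {S : CarnotStructure G} {N : G → ℝ}

theorem SphericalMVP.ae_spherical [MeasurableSpace G] {σ : Measure (unitSphere N)} {u : G → ℝ}
    (h : S.SphericalMVP N σ u) (p : G) :
    ∀ᵐ r ∂S.radialMeasure,
      ∫ v : unitSphere N, u (p * S.dilation r v) ∂σ = u p * σ.real Set.univ := by
  filter_upwards [S.ae_radialMeasure_pos] with r hr
  rw [← (h p r hr).2]
  simp

theorem isCompact_pball [FiniteDimensional ℝ G] [LieGroup 𝓘(ℝ, G) ∞ G]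
    (hN : S.IsPseudonorm N) (p : G) (R : ℝ) : IsCompact (pball N p R) := by
  have h := (hN.isCompact_le R).image (contDiff_mul_left p).continuous
  rwa [← preimage_pball N p R, Set.image_preimage_eq _ (Group.mulLeft_bijective p).2] at h

theorem measurableEmbedding_mul_left' [LieGroup 𝓘(ℝ, G) ∞ G] [MeasurableSpace G] [BorelSpace G]
    (p : G) : MeasurableEmbedding fun q : G => p * q := by
  have := topologicalGroup_of_lieGroup 𝓘(ℝ, G) ∞ (G := G)
  exact (Homeomorph.mulLeft p).measurableEmbedding

variable [FiniteDimensional ℝ G] [MeasurableSpace G] [BorelSpace G]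

section Polar

variable {μ : Measure G} {σ : Measure (unitSphere N)} [IsFiniteMeasure σ]

theorem IsPolarMeasure.integrable_comp_polarMap (hσ : S.IsPolarMeasure μ N σ)
    (hN : S.IsPseudonorm N) {F : G → ℝ} {w : ℝ → ℝ}
    (hF : Integrable (fun q => F q * w (N q)) μ) :
    Integrable (fun z : ℝ × unitSphere N => F (S.polarMap N z) * w z.1)
      (S.radialMeasure.prod σ) := by
  refine (hσ.measurePreserving.integrable_comp_of_integrable hF).congr ?_
  have hpos : ∀ᵐ z ∂(S.radialMeasure.prod σ), 0 < z.1 :=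
    Measure.quasiMeasurePreserving_fst.ae S.ae_radialMeasure_pos
  filter_upwards [hpos] with z hz
  simp only [Function.comp]
  rw [show N (S.polarMap N z) = z.1 from hN.dilation_mem_unitSphere hz z.2.2]

/-- No integrability on individual spheres is needed: by Fubini it can fail only for a null set of
radii, where the integral takes the default value `0`. -/
theorem IsPolarMeasure.integrable_radial (hσ : S.IsPolarMeasure μ N σ)
    (hN : S.IsPseudonorm N) {F : G → ℝ} {w : ℝ → ℝ}
    (hF : Integrable (fun q => F q * w (N q)) μ) :
    Integrable (fun r => (∫ v : unitSphere N, F (S.dilation r v) ∂σ) * w r) S.radialMeasure := by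
  have h := (hσ.integrable_comp_polarMap hN hF).integral_prod_left
  simp only [integral_mul_const] at h
  exact h

theorem IsPolarMeasure.integral_radial (hσ : S.IsPolarMeasure μ N σ)
    (hN : S.IsPseudonorm N) {F : G → ℝ} {w : ℝ → ℝ}
    (hF : Integrable (fun q => F q * w (N q)) μ) :
    ∫ q, F q * w (N q) ∂μ =
      ∫ r, (∫ v : unitSphere N, F (S.dilation r v) ∂σ) * w r ∂S.radialMeasure := by
  have hm := hσ.measurePreserving
  rw [← hm.map_eq, integral_map hm.measurable.aemeasurable
    (by rw [hm.map_eq]; exact hF.aestronglyMeasurable)]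
  have h : ∀ᵐ z ∂(S.radialMeasure.prod σ), F (S.polarMap N z) * w (N (S.polarMap N z)) =
      F (S.polarMap N z) * w z.1 := by
    have hpos : ∀ᵐ z ∂(S.radialMeasure.prod σ), 0 < z.1 :=
      Measure.quasiMeasurePreserving_fst.ae S.ae_radialMeasure_pos
    filter_upwards [hpos] with z hz
    rw [show N (S.polarMap N z) = z.1 from hN.dilation_mem_unitSphere hz z.2.2]
  rw [integral_congr_ae h, integral_prod _ (hσ.integrable_comp_polarMap hN hF)]
  simp only [integral_mul_const]
  rfl

/-- If the spherical means of `F` around the origin are almost all equal to `c`, then so are all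
radially weighted means. -/
theorem IsPolarMeasure.integral_mul_radial_eq (hσ : S.IsPolarMeasure μ N σ)
    (hN : S.IsPseudonorm N) {F : G → ℝ} {c : ℝ}
    (hmean : ∀ᵐ r ∂S.radialMeasure, ∫ v : unitSphere N, F (S.dilation r v) ∂σ = c * σ.real Set.univ)
    {w : ℝ → ℝ} (hw : Integrable (fun q => w (N q)) μ)
    (hF : Integrable (fun q => F q * w (N q)) μ) :
    ∫ q, F q * w (N q) ∂μ = c * ∫ q, w (N q) ∂μ := by
  have h1 := hσ.integral_radial hN (F := fun _ => 1) (w := w) (by simpa using hw)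
  simp only [one_mul, integral_const, smul_eq_mul, mul_one] at h1
  rw [hσ.integral_radial hN hF, h1, ← integral_const_mul]
  refine integral_congr_ae ?_
  filter_upwards [hmean] with r hr
  rw [hr, mul_assoc]

end Polar

theorem integrable_mul_radial (μ : Measure G) [μ.IsAddHaarMeasure]
    (hN : S.IsPseudonorm N) {F : G → ℝ} {R C : ℝ}
    (hF : IntegrableOn F {q | N q ≤ R} μ) {w : ℝ → ℝ} (hw : Measurable w) (hC : ∀ t, |w t| ≤ C)
    (hR : ∀ t, R < t → w t = 0) : Integrable (fun q => F q * w (N q)) μ := by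
  have hB : MeasurableSet {q | N q ≤ R} := (hN.isCompact_le R).measurableSet
  have h : IntegrableOn (fun q => F q * w (N q)) {q | N q ≤ R} μ :=
    hF.mul_bdd (c := C) (hw.comp hN.continuous.measurable).aestronglyMeasurable
      (Filter.Eventually.of_forall fun q => hC _)
  refine (integrableOn_iff_integrable_of_support_subset fun q hq => ?_).1 h
  by_contra hlt
  exact hq (by simp [hR _ (not_le.1 hlt)])

theorem integrable_radial_weight (μ : Measure G) [μ.IsAddHaarMeasure]
    (hN : S.IsPseudonorm N) {R C : ℝ}
    {w : ℝ → ℝ} (hw : Measurable w) (hC : ∀ t, |w t| ≤ C)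
    (hR : ∀ t, R < t → w t = 0) : Integrable (fun q => w (N q)) μ := by
  have h := integrable_mul_radial μ hN (F := fun _ => 1)
    (integrableOn_const (hN.isCompact_le R).measure_lt_top.ne) hw hC hR
  simpa using h

variable [LieGroup 𝓘(ℝ, G) ∞ G]

variable (μ : Measure G) [μ.IsAddHaarMeasure]

theorem measurePreserving_mul_left' (S : CarnotStructure G) (p : G) :
    MeasurePreserving (fun q => p * q) μ μ := by
  have := S.isMulLeftInvariant μ
  exact ⟨(contDiff_mul_left p).continuous.measurable, this.map_mul_left_eq_self p⟩

theorem setIntegral_pball (S : CarnotStructure G) (u : G → ℝ) (p : G) (R : ℝ) :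
    ∫ q in pball N p R, u q ∂μ = ∫ q in {q | N q ≤ R}, u (p * q) ∂μ := by
  rw [← (S.measurePreserving_mul_left' μ p).setIntegral_preimage_emb
    (measurableEmbedding_mul_left' p), preimage_pball]

theorem measureReal_pball (hN : S.IsPseudonorm N) (p : G) (R : ℝ) :
    μ.real (pball N p R) = μ.real {q | N q ≤ R} := by
  rw [measureReal_def, measureReal_def, ← preimage_pball N p R,
    (S.measurePreserving_mul_left' μ p).measure_preimage
      (isCompact_pball hN p R).measurableSet.nullMeasurableSet]

theorem integrableOn_comp_mul_left (hN : S.IsPseudonorm N) {u : G → ℝ}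
    (hu : LocallyIntegrable u μ) (p : G) (R : ℝ) :
    IntegrableOn (fun q => u (p * q)) {q | N q ≤ R} μ := by
  rw [← preimage_pball N p R]
  exact ((S.measurePreserving_mul_left' μ p).integrableOn_comp_preimage
    (measurableEmbedding_mul_left' p)).2 (hu.integrableOn_isCompact (isCompact_pball hN p R))

variable {μ} {σ : Measure (unitSphere N)} [IsFiniteMeasure σ]

/-- The ball means around `p` determine almost all spherical means around `p`. -/
theorem VolumeMVP.ae_spherical {u : G → ℝ} (h : VolumeMVP μ N u) (hN : S.IsPseudonorm N)
    (hσ : S.IsPolarMeasure μ N σ) [Nontrivial G] (hu : LocallyIntegrable u μ) (p : G) :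
    ∀ᵐ r ∂S.radialMeasure,
      ∫ v : unitSphere N, u (p * S.dilation r v) ∂σ = u p * σ.real Set.univ := by
  have hw : ∀ (R : ℝ) (F : G → ℝ), (fun q => F q * (Set.Iic R).indicator (1 : ℝ → ℝ) (N q)) =
      Set.indicator {q | N q ≤ R} F := fun R F => by
    ext q
    by_cases hq : N q ≤ R <;> simp [Set.indicator, hq]
  have hr : ∀ (R : ℝ) (f : ℝ → ℝ), (fun r => f r * (Set.Iic R).indicator (1 : ℝ → ℝ) r) =
      Set.indicator (Set.Iic R) f := fun R f => by
    ext q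
    by_cases hq : q ≤ R <;> simp [Set.indicator, hq]
  have hB : ∀ R, MeasurableSet {q | N q ≤ R} := fun R => (hN.isCompact_le R).measurableSet
  have hint : ∀ R, Integrable (fun q => (u (p * q) - u p) *
      (Set.Iic R).indicator (1 : ℝ → ℝ) (N q)) μ := fun R => by
    rw [hw R fun q => u (p * q) - u p, integrable_indicator_iff (hB R)]
    exact (integrableOn_comp_mul_left μ hN hu p R).sub
      (integrableOn_const (hN.isCompact_le R).measure_lt_top.ne)
  have hint' : ∀ R, Integrable (fun q => u (p * q) *
      (Set.Iic R).indicator (1 : ℝ → ℝ) (N q)) μ := fun R => by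
    rw [hw R fun q => u (p * q), integrable_indicator_iff (hB R)]
    exact integrableOn_comp_mul_left μ hN hu p R
  have hint1 : ∀ R, Integrable (fun q => u p *
      (Set.Iic R).indicator (1 : ℝ → ℝ) (N q)) μ := fun R => by
    rw [hw R fun q => u p, integrable_indicator_iff (hB R)]
    exact integrableOn_const (hN.isCompact_le R).measure_lt_top.ne
  have hI : ∀ R, IntegrableOn (fun r => ∫ v : unitSphere N, u (p * S.dilation r v) ∂σ)
      (Set.Iic R) S.radialMeasure := fun R => by
    have := hσ.integrable_radial hN (hint' R)
    rwa [hr R, integrable_indicator_iff measurableSet_Iic] at this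
  have hI1 : ∀ R, IntegrableOn (fun r => u p * σ.real Set.univ)
      (Set.Iic R) S.radialMeasure := fun R =>
    integrableOn_const (S.radialMeasure_Iic_lt_top R).ne
  -- `H` is the deviation of the spherical integral from its expected value; its integral up to `R`
  -- is the deviation of the ball integral, for `R > 0`.
  have key := ae_eq_zero_of_setIntegral_Iic_eq_zero (ν := S.radialMeasure)
    (H := fun r => ∫ v : unitSphere N, u (p * S.dilation r v) ∂σ - u p * σ.real Set.univ)
    (fun R => (hI R).sub (hI1 R)) fun R => ?_
  · filter_upwards [key] with r hr
    exact sub_eq_zero.1 hr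
  rcases le_or_gt R 0 with hR | hR
  · exact setIntegral_measure_zero _ (S.radialMeasure_Iic_of_nonpos hR)
  have hpos : 0 < μ.real {q | N q ≤ R} := by
    refine ENNReal.toReal_pos ?_ (hN.isCompact_le R).measure_lt_top.ne
    have ho : IsOpen {q | N q < R} := isOpen_lt hN.continuous continuous_const
    refine ((ho.measure_pos μ ⟨0, ?_⟩).trans_le (measure_mono fun q (hq : N q < R) => hq.le)).ne'
    change N 0 < R
    rwa [hN.map_zero]
  have hv := h p R hR
  rw [setAverage_eq, setIntegral_pball μ S, measureReal_pball μ hN, smul_eq_mul,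
    eq_inv_mul_iff_mul_eq₀ hpos.ne'] at hv
  have e1 := hσ.integral_radial hN (hint' R)
  have e2 := hσ.integral_radial hN (hint1 R)
  rw [hw R fun q => u (p * q), integral_indicator (hB R), hr R, integral_indicator
    measurableSet_Iic] at e1
  rw [hw R fun q => u p, integral_indicator (hB R), hr R, integral_indicator
    measurableSet_Iic] at e2
  rw [integral_sub (hI R) (hI1 R), ← e1, ← hv, sub_eq_zero]
  simp only [integral_const, smul_eq_mul, measureReal_restrict_apply_univ] at e2
  rw [e2]
  simp [mul_comm]


/-! ### The radial bump and smoothing by group convolution. -/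

variable {G : Type*} [NormedAddCommGroup G] [NormedSpace ℝ G] [Group G]
  {S : CarnotStructure G} {N : G → ℝ}

/-- The profile of the bump function as a function of the pseudonorm. -/
noncomputable def bumpProfile (k : ℕ) (t : ℝ) : ℝ :=
  if t < 1 then Real.exp (-(1 / (1 - t ^ k))) else 0

theorem rawBump_eq {G : Type*} (N : G → ℝ) (k : ℕ) (q : G) :
    rawBump N k q = bumpProfile k (N q) := rfl

theorem measurable_bumpProfile (k : ℕ) : Measurable (bumpProfile k) :=
  Measurable.ite measurableSet_Iio (by fun_prop) measurable_const

theorem bumpProfile_of_one_le (k : ℕ) {t : ℝ} (ht : 1 ≤ t) : bumpProfile k t = 0 :=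
  if_neg (not_lt.2 ht)

theorem bumpProfile_pos (k : ℕ) {t : ℝ} (ht : t < 1) : 0 < bumpProfile k t := by
  rw [bumpProfile, if_pos ht]
  exact Real.exp_pos _

theorem bumpProfile_nonneg (k : ℕ) (t : ℝ) : 0 ≤ bumpProfile k t := by
  rcases lt_or_ge t 1 with h | h
  · exact (bumpProfile_pos k h).le
  · exact (bumpProfile_of_one_le k h).ge

theorem bumpProfile_le_one (k : ℕ) {t : ℝ} (h0 : 0 ≤ t) : bumpProfile k t ≤ 1 := by
  rcases lt_or_ge t 1 with h | h
  · rw [bumpProfile, if_pos h, Real.exp_le_one_iff, neg_nonpos]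
    exact one_div_nonneg.2 (sub_nonneg.2 (pow_le_one₀ h0 h.le))
  · rw [bumpProfile_of_one_le k h]
    exact zero_le_one

/-- The function of the pseudonorm underlying the rescaled bump, cut off at negative arguments. -/
noncomputable def rescaledProfile (Q k : ℕ) (c ε : ℝ) (t : ℝ) : ℝ :=
  (ε ^ Q)⁻¹ * (c * (Set.Ici 0).indicator (bumpProfile k) (ε⁻¹ * t))

theorem measurable_rescaledProfile (Q k : ℕ) (c ε : ℝ) : Measurable (rescaledProfile Q k c ε) :=
  ((((measurable_bumpProfile k).indicator measurableSet_Ici).comp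
    (measurable_const_mul _)).const_mul c).const_mul _

/-- The cutoff makes this bound hold for all `t`: for even positive `k`, the uncut `bumpProfile`
blows up just to the left of `-1`. -/
theorem abs_rescaledProfile_le (Q k : ℕ) (c ε t : ℝ) :
    |rescaledProfile Q k c ε t| ≤ |(ε ^ Q)⁻¹| * |c| := by
  rw [rescaledProfile, abs_mul, abs_mul]
  refine mul_le_mul_of_nonneg_left (mul_le_of_le_one_right (abs_nonneg _) ?_) (abs_nonneg _)
  by_cases h : ε⁻¹ * t ∈ Set.Ici (0 : ℝ)
  · rw [Set.indicator_of_mem h, abs_of_nonneg (bumpProfile_nonneg _ _)]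
    exact bumpProfile_le_one k h
  · simp [Set.indicator_of_notMem h]

theorem rescaledProfile_of_lt (Q k : ℕ) (c : ℝ) {ε t : ℝ} (hε : 0 < ε) (ht : ε < t) :
    rescaledProfile Q k c ε t = 0 := by
  have h : 1 ≤ ε⁻¹ * t := by
    rw [inv_mul_eq_div, one_le_div hε]
    exact ht.le
  rw [rescaledProfile, Set.indicator_of_mem (Set.mem_Ici.2 (zero_le_one.trans h)),
    bumpProfile_of_one_le k h, mul_zero, mul_zero]

theorem rescale_bump_eq [MeasurableSpace G] (μ : Measure G) (hN : S.IsPseudonorm N) (k : ℕ)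
    {ε : ℝ} (hε : 0 < ε) (q : G) :
    S.rescale (bump μ N k) ε q =
      rescaledProfile S.homDim k (∫ x, rawBump N k x ∂μ)⁻¹ ε (N q) := by
  rw [rescale, bump, rawBump_eq, rescaledProfile, one_div, hN.homogeneous _ (inv_pos.2 hε),
    Set.indicator_of_mem (Set.mem_Ici.2 (mul_nonneg (inv_pos.2 hε).le (hN.nonneg q)))]

variable [FiniteDimensional ℝ G] [MeasurableSpace G] [BorelSpace G]

/-- The group convolution is an additive convolution evaluated at `0`, whose kernel `y ↦ φ((-y)⁻¹
p)` depends smoothly on the parameter `p`. For `p` near `p₀` all these kernels are supported in one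
compact set. -/
theorem contDiff_conv [LieGroup 𝓘(ℝ, G) ∞ G] {μ : Measure G} (hN : S.IsPseudonorm N)
    {u : G → ℝ} (hu : LocallyIntegrable u μ)
    {φ : G → ℝ} (hφ : ContDiff ℝ ∞ φ) {R : ℝ} (hR : ∀ q, R < N q → φ q = 0) :
    ContDiff ℝ ∞ (conv μ u φ) := by
  refine contDiff_iff_contDiffAt.2 fun p₀ => ?_
  have hinv : Continuous fun q : G => q⁻¹ := contDiff_inv.continuous
  have hmul : Continuous fun x : G × G => x.1 * x.2 := contDiff_mul.continuous
  -- Solving `(-y)⁻¹ p = s` for `y` gives `y = -(p s⁻¹)`, with `p` in the closed unit ball around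
  -- `p₀` and `N s ≤ R`.
  let K : Set G := (fun x : G × G => -(x.1 * x.2⁻¹)) ''
    (Metric.closedBall p₀ 1 ×ˢ {q | N q ≤ R})
  have hK : IsCompact K := ((isCompact_closedBall p₀ 1).prod (hN.isCompact_le R)).image
    (hmul.comp (continuous_fst.prodMk (hinv.comp continuous_snd))).neg
  have hg : ContDiffOn ℝ ∞ (Function.uncurry fun p y : G => φ ((-y)⁻¹ * p))
      (Metric.ball p₀ 1 ×ˢ Set.univ) :=
    (hφ.comp (contDiff_mul.comp
      ((contDiff_inv.comp contDiff_snd.neg).prodMk contDiff_fst))).contDiffOn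
  have hsupp : ∀ p y : G, p ∈ Metric.ball p₀ 1 → y ∉ K → φ ((-y)⁻¹ * p) = 0 := by
    intro p y hp hy
    refine hR _ (not_le.1 fun hle => hy ⟨(p, (-y)⁻¹ * p),
      ⟨Metric.ball_subset_closedBall hp, hle⟩, ?_⟩)
    simp
  have h := contDiffOn_convolution_right_with_param_comp (n := ⊤) (ContinuousLinearMap.mul ℝ ℝ)
    (v := fun _ : G => (0 : G)) contDiffOn_const Metric.isOpen_ball hK hsupp hu hg
  have h' : (fun p => convolution u (fun y => φ ((-y)⁻¹ * p)) (ContinuousLinearMap.mul ℝ ℝ) μ 0) =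
      conv μ u φ := by
    ext p
    simp [convolution, conv]
  rw [← h']
  exact h.contDiffAt (Metric.ball_mem_nhds p₀ one_pos)

variable (μ : Measure G) [μ.IsAddHaarMeasure]

theorem integral_rawBump_pos (hN : S.IsPseudonorm N) (k : ℕ) : 0 < ∫ x, rawBump N k x ∂μ := by
  have hint : Integrable (rawBump N k) μ := by
    -- With exponent `0` and both constants `1`, the rescaled profile is the raw one on `[0, ∞)`.
    refine (integrable_radial_weight μ hN (measurable_rescaledProfile 0 k 1 1)
      (abs_rescaledProfile_le 0 k 1 1) fun t ht => rescaledProfile_of_lt 0 k 1 one_pos ht).congr ?_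
    refine Filter.Eventually.of_forall fun q => ?_
    simp [rescaledProfile, rawBump_eq, hN.nonneg q]
  refine (integral_pos_iff_support_of_nonneg (fun q => bumpProfile_nonneg k (N q)) hint).2 ?_
  have ho : IsOpen {q | N q < 1} := isOpen_lt hN.continuous continuous_const
  refine (ho.measure_pos μ ⟨0, ?_⟩).trans_le
    (measure_mono fun q (hq : N q < 1) => (bumpProfile_pos k hq).ne')
  change N 0 < 1
  rw [hN.map_zero]
  exact one_pos

theorem integral_rescale (S : CarnotStructure G) (φ : G → ℝ) {ε : ℝ} (hε : 0 < ε) :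
    ∫ q, S.rescale φ ε q ∂μ = ∫ q, φ q ∂μ := by
  have hε' := inv_pos.2 hε
  have hd : LinearMap.det (S.dilation ε⁻¹) ≠ 0 := by
    rw [S.det_dilation]
    exact (pow_pos hε' _).ne'
  have hemb : MeasurableEmbedding (S.dilation ε⁻¹) :=
    ((LinearEquiv.ofIsUnitDet (f := S.dilation ε⁻¹) (v := Module.finBasis ℝ G)
      (v' := Module.finBasis ℝ G) (by
        rw [LinearMap.det_toMatrix]
        exact hd.isUnit)).toContinuousLinearEquiv.toHomeomorph).measurableEmbedding
  have h := hemb.integral_map (μ := μ) φ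
  rw [Measure.map_linearMap_addHaar_eq_smul_addHaar μ hd, S.det_dilation, inv_pow, inv_inv,
    abs_of_pos (pow_pos hε _), integral_smul_measure,
    ENNReal.toReal_ofReal (pow_pos hε _).le, smul_eq_mul] at h
  simp only [rescale, one_div]
  rw [integral_const_mul, ← h, inv_mul_cancel_left₀ (pow_pos hε _).ne']

theorem integral_rescale_bump (hN : S.IsPseudonorm N) (k : ℕ) {ε : ℝ} (hε : 0 < ε) :
    ∫ q, S.rescale (bump μ N k) ε q ∂μ = 1 := by
  rw [integral_rescale μ S _ hε]
  simp only [bump]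
  rw [integral_const_mul, inv_mul_cancel₀ (integral_rawBump_pos μ hN k).ne']

/-! ### Consequences of the spherical identity for almost every radius. -/

variable [LieGroup 𝓘(ℝ, G) ∞ G] {μ}

variable {σ : Measure (unitSphere N)} [IsFiniteMeasure σ]

theorem conv_rescale_bump_eq (hN : S.IsPseudonorm N) (hσ : S.IsPolarMeasure μ N σ)
    {u : G → ℝ} (hu : LocallyIntegrable u μ)
    (hmean : ∀ p, ∀ᵐ r ∂S.radialMeasure,
      ∫ v : unitSphere N, u (p * S.dilation r v) ∂σ = u p * σ.real Set.univ)
    (k : ℕ) {ε : ℝ} (hε : 0 < ε) : conv μ u (S.rescale (bump μ N k) ε) = u := by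
  ext p
  have h1 := integral_rescale_bump μ hN k hε
  simp only [rescale_bump_eq μ hN k hε] at h1
  rw [conv, ← (S.measurePreserving_mul_left' μ p).integral_comp
    (measurableEmbedding_mul_left' p)]
  -- After left translation by `p` the bump is evaluated at `(pq)⁻¹ p = q⁻¹`; symmetry of `N` makes
  -- it a radial weight in `q`.
  have h2 : ∀ q, S.rescale (bump μ N k) ε ((p * q)⁻¹ * p) =
      rescaledProfile S.homDim k (∫ x, rawBump N k x ∂μ)⁻¹ ε (N q) := fun q => by
    rw [rescale_bump_eq μ hN k hε, mul_inv_rev, inv_mul_cancel_right, hN.symm]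
  simp only [h2]
  have hm := measurable_rescaledProfile S.homDim k (∫ x, rawBump N k x ∂μ)⁻¹ ε
  have hb := abs_rescaledProfile_le S.homDim k (∫ x, rawBump N k x ∂μ)⁻¹ ε
  have h0 : ∀ t, ε < t → rescaledProfile S.homDim k (∫ x, rawBump N k x ∂μ)⁻¹ ε t = 0 :=
    fun t ht => rescaledProfile_of_lt _ k _ hε ht
  generalize rescaledProfile S.homDim k (∫ x, rawBump N k x ∂μ)⁻¹ ε = w at h1 hm hb h0 ⊢
  have h := hσ.integral_mul_radial_eq hN (F := fun q => u (p * q)) (w := w) (hmean p)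
    (integrable_radial_weight μ hN hm hb h0)
    (integrable_mul_radial μ hN (integrableOn_comp_mul_left μ hN hu p ε) hm hb h0)
  rw [h, h1, mul_one]

theorem contDiff_of_ae_spherical (hN : S.IsPseudonorm N) (hσ : S.IsPolarMeasure μ N σ)
    {u : G → ℝ} (hu : LocallyIntegrable u μ)
    (hmean : ∀ p, ∀ᵐ r ∂S.radialMeasure,
      ∫ v : unitSphere N, u (p * S.dilation r v) ∂σ = u p * σ.real Set.univ)
    {k : ℕ} (hψ : ContDiff ℝ ∞ (bump μ N k)) : ContDiff ℝ ∞ u := by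
  rw [← conv_rescale_bump_eq hN hσ hu hmean k one_pos]
  refine contDiff_conv hN hu (R := 1) ?_ fun q hq => ?_
  · exact contDiff_const.mul (hψ.comp
      (LinearMap.toContinuousLinearMap (S.dilation (1 / 1))).contDiff)
  · rw [rescale_bump_eq μ hN k one_pos]
    exact rescaledProfile_of_lt _ k _ one_pos hq

theorem sphericalMVP_of_ae_spherical (hN : S.IsPseudonorm N) {u : G → ℝ} (hu : Continuous u)
    (hmean : ∀ p, ∀ᵐ r ∂S.radialMeasure,
      ∫ v : unitSphere N, u (p * S.dilation r v) ∂σ = u p * σ.real Set.univ) :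
    S.SphericalMVP N σ u := by
  intro p r hr
  have := isCompact_iff_compactSpace.1 hN.isCompact_unitSphere
  have hc : Continuous fun x : ℝ × unitSphere N => u (p * S.dilation x.1 x.2) :=
    hu.comp ((contDiff_mul_left p).continuous.comp continuous_polarMap)
  have hcr : Continuous fun r : ℝ => ∫ v : unitSphere N, u (p * S.dilation r v) ∂σ := by
    have := continuous_parametric_integral_of_continuous (μ := σ)
      (f := fun (r : ℝ) (v : unitSphere N) => u (p * S.dilation r v)) hc isCompact_univ
    simpa using this
  refine ⟨?_, ?_⟩
  · have h1 : Continuous fun v : unitSphere N => u (p * S.dilation r v) :=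
      hc.comp (continuous_const.prodMk continuous_id)
    have := h1.continuousOn.integrableOn_compact (μ := σ) isCompact_univ
    rwa [integrableOn_univ] at this
  · have hae : ∀ᵐ r ∂volume.restrict (Set.Ioi (0 : ℝ)),
        ∫ v : unitSphere N, u (p * S.dilation r v) ∂σ = u p * σ.real Set.univ := by
      -- The density `r^{Q-1}` is positive on `(0, ∞)`, so null sets of the radial measure are
      -- Lebesgue null there. Two continuous functions of `r` that agree almost everywhere on this
      -- open set agree throughout it.
      refine (withDensity_absolutelyContinuous' (by fun_prop) ?_).ae_le (hmean p)
      filter_upwards [ae_restrict_mem measurableSet_Ioi] with r hr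
      simpa using pow_pos hr _
    have := Measure.eqOn_open_of_ae_eq hae isOpen_Ioi hcr.continuousOn continuousOn_const hr
    simpa using this.symm

theorem volumeMVP_of_ae_spherical (hN : S.IsPseudonorm N) (hσ : S.IsPolarMeasure μ N σ)
    {u : G → ℝ} (hu : LocallyIntegrable u μ)
    (hmean : ∀ p, ∀ᵐ r ∂S.radialMeasure,
      ∫ v : unitSphere N, u (p * S.dilation r v) ∂σ = u p * σ.real Set.univ) :
    VolumeMVP μ N u := by
  intro p R hR
  have hw : ∀ F : G → ℝ, (fun q => F q * (Set.Iic R).indicator (1 : ℝ → ℝ) (N q)) =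
      Set.indicator {q | N q ≤ R} F := fun F => by
    ext q
    by_cases hq : N q ≤ R <;> simp [Set.indicator, hq]
  have hB : MeasurableSet {q | N q ≤ R} := (hN.isCompact_le R).measurableSet
  have hpos : 0 < μ.real {q | N q ≤ R} := by
    refine ENNReal.toReal_pos ?_ (hN.isCompact_le R).measure_lt_top.ne
    have ho : IsOpen {q | N q < R} := isOpen_lt hN.continuous continuous_const
    refine ((ho.measure_pos μ ⟨0, ?_⟩).trans_le
      (measure_mono fun q (hq : N q < R) => hq.le)).ne'
    change N 0 < R
    rwa [hN.map_zero]
  have hm : Measurable ((Set.Iic R).indicator (1 : ℝ → ℝ)) :=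
    measurable_one.indicator measurableSet_Iic
  have hb : ∀ t, |(Set.Iic R).indicator (1 : ℝ → ℝ) t| ≤ 1 := fun t => by
    by_cases ht : t ≤ R <;> simp [Set.indicator, ht]
  have h0 : ∀ t, R < t → (Set.Iic R).indicator (1 : ℝ → ℝ) t = 0 := fun t ht =>
    Set.indicator_of_notMem (Set.notMem_Iic.2 ht) _
  have h := hσ.integral_mul_radial_eq hN (F := fun q => u (p * q))
    (w := (Set.Iic R).indicator 1) (hmean p) (integrable_radial_weight μ hN hm hb h0)
    (integrable_mul_radial μ hN (integrableOn_comp_mul_left μ hN hu p R) hm hb h0)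
  have h1 := hw fun _ => 1
  simp only [one_mul] at h1
  rw [hw fun q => u (p * q), h1, integral_indicator hB, integral_indicator hB] at h
  simp only [integral_const, smul_eq_mul, measureReal_restrict_apply_univ, mul_one] at h
  rw [setAverage_eq, setIntegral_pball μ S, measureReal_pball μ hN, smul_eq_mul,
    eq_inv_mul_iff_mul_eq₀ hpos.ne', h, mul_comm]

end CarnotStructure

theorem theorem4p3 {G : Type*} [NormedAddCommGroup G] [NormedSpace ℝ G] [FiniteDimensional ℝ G]
    [Nontrivial G] [MeasurableSpace G] [BorelSpace G] [Group G] [LieGroup 𝓘(ℝ, G) ∞ G]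
    (S : CarnotStructure G) (μ : Measure G) [μ.IsAddHaarMeasure]
    (N : G → ℝ) (hN : S.IsPseudonorm N)
    (k : ℕ) (hk : 0 < k) (hψ : ContDiff ℝ ∞ (CarnotStructure.bump μ N k)) :
    (∃! σ : Measure (CarnotStructure.unitSphere N), S.IsPolarMeasure μ N σ) ∧
    ∀ σ : Measure (CarnotStructure.unitSphere N), S.IsPolarMeasure μ N σ →
      ∀ u : G → ℝ, LocallyIntegrable u μ →
        (CarnotStructure.VolumeMVP μ N u ↔ S.SphericalMVP N σ u) ∧
        (CarnotStructure.VolumeMVP μ N u ∨ S.SphericalMVP N σ u →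
          ContDiff ℝ ∞ u ∧
          ∀ ε : ℝ, 0 < ε →
            CarnotStructure.conv μ u (S.rescale (CarnotStructure.bump μ N k) ε) = u) := by
  refine ⟨CarnotStructure.existsUnique_isPolarMeasure μ hN, fun σ hσ u hu => ?_⟩
  have := hσ.isFiniteMeasure hN
  have hvol : CarnotStructure.VolumeMVP μ N u → S.SphericalMVP N σ u := fun h =>
    CarnotStructure.sphericalMVP_of_ae_spherical hN
      (CarnotStructure.contDiff_of_ae_spherical hN hσ hu (h.ae_spherical hN hσ hu) hψ).continuous
      (h.ae_spherical hN hσ hu)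
  refine ⟨⟨hvol, fun h => CarnotStructure.volumeMVP_of_ae_spherical hN hσ hu h.ae_spherical⟩,
    fun h => ?_⟩
  have hs : S.SphericalMVP N σ u := h.elim hvol id
  exact ⟨CarnotStructure.contDiff_of_ae_spherical hN hσ hu hs.ae_spherical hψ,
    fun ε hε => CarnotStructure.conv_rescale_bump_eq hN hσ hu hs.ae_spherical k hε⟩
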